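/- For $n\in\mathbb N$ let $C_m^{(n)}(\sigma)$ be the number of cycles of length $m$ of a permutation $\sigma\in S_n$ (fixed points are cycles of length $1$), where $\sigma$ is chosen uniformly at random from $S_n$. Let $\mathrm{Log}$ be the principal branch of the logarithm, and for $x,s\in\mathbb C$ with $|x|<1$ put $$Z_n^s(x)=\prod_{m=1}^n(1-x^m)^{sC_m^{(n)}},$$ where the powers are principal powers $(1-x^m)^{w}=\exp(w\,\mathrm{Log}(1-x^m))$. Let $Y_1,Y_2,\dots$ be independent random variables, $Y_m$ being Poisson distributed with mean $1/m$, and put $$Z_\infty^s(x)=\prod_{m=1}^\infty(1-x^m)^{sY_m}.$$ **Lemma.** For all fixed $x,s\in\mathbb C$ with $|x|<1$, the series $\sum_{m\ge1}Y_m\,\mathrm{Log}(1-x^m)$ is almost surely absolutely convergent, the infinite product $Z_\infty^s(x)$ is almost surely (unconditionally) convergent, and, as $n\to\infty$, $$s\sum_{m=1}^n C_m^{(n)}\,\mathrm{Log}(1-x^m)\ \xrightarrow{d}\ s\sum_{m=1}^\infty Y_m\,\mathrm{Log}(1-x^m),\qquad Z_n^s(x)\ \xrightarrow{d}\ Z_\infty^s(x).$$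 -/

import Mathlib

open Filter MeasureTheory ProbabilityTheory
open scoped NNReal

noncomputable section

/-- Every subset of the symmetric group `S_n` is an event. -/
instance permMeasurableSpace (n : ℕ) : MeasurableSpace (Equiv.Perm (Fin n)) := ⊤

/-- The uniform probability measure on the symmetric group `S_n`. -/
def uniformPerm (n : ℕ) : Measure (Equiv.Perm (Fin n)) :=
  (PMF.uniformOfFintype (Equiv.Perm (Fin n))).toMeasure

instance uniformPerm_isProbabilityMeasure (n : ℕ) : IsProbabilityMeasure (uniformPerm n) :=
  inferInstanceAs (IsProbabilityMeasure (PMF.uniformOfFintype (Equiv.Perm (Fin n))).toMeasure)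

/-- The number of cycles of length `m` of `σ`, where the fixed points of `σ` are its cycles of
length one. -/
def cycleCount {n : ℕ} (m : ℕ) (σ : Equiv.Perm (Fin n)) : ℕ :=
  σ.partition.parts.count m

/-- The logarithm `s ∑_{m = 1}^n C_m Log (1 - x ^ m)` of `Z_n^s(x)`, as a function on `S_n`. -/
def logZ (n : ℕ) (s x : ℂ) (σ : Equiv.Perm (Fin n)) : ℂ :=
  s * ∑ m ∈ Finset.Icc 1 n, (cycleCount m σ : ℂ) * Complex.log (1 - x ^ m)

/-- `Z_n^s(x) = ∏_{m = 1}^n (1 - x ^ m) ^ (s C_m)`, as a function on `S_n`; the powers are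
principal ones. -/
def charZ (n : ℕ) (s x : ℂ) (σ : Equiv.Perm (Fin n)) : ℂ :=
  ∏ m ∈ Finset.Icc 1 n, (1 - x ^ m) ^ (s * (cycleCount m σ : ℂ))

/-- `s ∑_{m = 1}^∞ y_m Log (1 - x ^ m)`. -/
def logZInf (s x : ℂ) (y : ℕ+ → ℕ) : ℂ :=
  s * ∑' m : ℕ+, (y m : ℂ) * Complex.log (1 - x ^ (m : ℕ))

/-- `∏_{m = 1}^∞ (1 - x ^ m) ^ (s y_m)`; with independent Poisson variables of mean `1 / m` in the
place of `y_m` this is `Z_∞^s(x)`. -/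
def charZInf (s x : ℂ) (y : ℕ+ → ℕ) : ℂ :=
  ∏' m : ℕ+, (1 - x ^ (m : ℕ)) ^ (s * (y m : ℂ))

end

/-! By Lévy's continuity theorem it suffices that characteristic functions converge. At `t`, that of
`logZ` is the mean over `S_n` of a product of phases `z m` over the cycles: the cycle index `a n`.
Formally, `∑ a n * u ^ n = exp (∑ z m * u ^ m / m) = (1 - u)⁻¹ * exp (∑ (z m - 1) * u ^ m / m)`. As
`z m - 1 = O(‖x‖ ^ m)`, the last factor is analytic beyond the unit disc. The factor `(1 - u)⁻¹`
makes `a n` a partial sum of its Taylor coefficients at `u = 1`, so `a n` tends to `exp (∑ (z m - 1)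
/ m)`, the characteristic function of the Poisson series.

The generating function enters only through its coefficient recursion (`mul_symmCycleIndex`,
`tendsto_of_recursion`). The limit law is computed in `charFun_map_logZInf`; the statement for `Z`
follows by applying `exp`. -/

/-! ### Cycle types and the cycle index of the symmetric group -/

open scoped Nat in
/-- The order of the centralizer of a permutation whose cycle lengths, fixed points included,
form the multiset `s`. -/
def centralizerOrder (s : Multiset ℕ) : ℕ :=
  s.prod * ∏ i ∈ s.toFinset, (s.count i)!

open scoped Nat in
theorem centralizerOrder_eq_of_subset {s : Multiset ℕ} {t : Finset ℕ} (h : s.toFinset ⊆ t) :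
    centralizerOrder s = s.prod * ∏ i ∈ t, (s.count i)! := by
  rw [centralizerOrder, Finset.prod_subset h]
  intro i _ hi
  rw [Multiset.mem_toFinset] at hi
  simp [Multiset.count_eq_zero_of_notMem hi]

theorem centralizerOrder_cons (m : ℕ) (s : Multiset ℕ) :
    centralizerOrder (m ::ₘ s) = m * (s.count m + 1) * centralizerOrder s := by
  have hm : m ∈ insert m s.toFinset := Finset.mem_insert_self _ _
  rw [centralizerOrder_eq_of_subset (t := insert m s.toFinset) (s := m ::ₘ s) (by simp),
    centralizerOrder_eq_of_subset (t := insert m s.toFinset) (s := s) (Finset.subset_insert _ _),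
    ← Finset.mul_prod_erase _ _ hm, ← Finset.mul_prod_erase _ _ hm, Multiset.prod_cons,
    Multiset.count_cons_self, Nat.factorial_succ]
  have : ∏ i ∈ (insert m s.toFinset).erase m, ((m ::ₘ s).count i).factorial
      = ∏ i ∈ (insert m s.toFinset).erase m, (s.count i).factorial := by
    refine Finset.prod_congr rfl fun i hi ↦ ?_
    rw [Multiset.count_cons_of_ne (Finset.ne_of_mem_erase hi)]
  rw [this]
  ring

theorem centralizerOrder_pos {n : ℕ} (p : n.Partition) : 0 < centralizerOrder p.parts := by
  have : 0 < p.parts.prod := Multiset.prod_pos fun a ha ↦ p.parts_pos ha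
  unfold centralizerOrder
  positivity

-- `cycleType` omits fixed points, so the known count by cycle type is applied to the parts `≥ 2`;
-- the `k` parts equal to `1` supply the factor `k!`.
open scoped Nat in
theorem card_partition_eq_mul_centralizerOrder {α : Type*} [Fintype α] [DecidableEq α]
    (p : (Fintype.card α).Partition) :
    (Finset.univ.filter fun σ : Equiv.Perm α ↦ σ.partition = p).card * centralizerOrder p.parts
      = (Fintype.card α)! := by
  set c := p.parts.filter (fun i ↦ 2 ≤ i) with hc
  set k := p.parts.count 1 with hk
  have hparts : p.parts = c + Multiset.replicate k 1 := by
    rw [hc, hk, ← Multiset.filter_eq', ← Multiset.filter_add_not (fun i ↦ 2 ≤ i) p.parts]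
    simp only [Multiset.filter_add, Multiset.filter_filter]
    have h1 : p.parts.filter (fun i ↦ ¬ 2 ≤ i) = p.parts.filter (fun i ↦ i = 1) := by
      refine Multiset.filter_congr fun i hi ↦ ?_
      have := p.parts_pos hi
      omega
    have h2 : p.parts.filter (fun i ↦ i = 1 ∧ 2 ≤ i) = 0 :=
      Multiset.filter_eq_nil.2 fun i _ ↦ by omega
    have h3 : p.parts.filter (fun i ↦ 2 ≤ i ∧ ¬ 2 ≤ i) = 0 :=
      Multiset.filter_eq_nil.2 fun i _ ↦ by omega
    have h4 : p.parts.filter (fun i ↦ i = 1 ∧ ¬ 2 ≤ i) = p.parts.filter (fun i ↦ i = 1) :=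
      Multiset.filter_congr fun i _ ↦ by omega
    simp only [h1, h2, h3, h4, and_self, add_zero, zero_add]
  have hsum : c.sum + k = Fintype.card α := by
    have := p.parts_sum
    rw [hparts] at this
    simpa using this
  have hc2 : ∀ a ∈ c, 2 ≤ a := fun a ha ↦ (Multiset.mem_filter.1 ha).2
  have hset : (Finset.univ.filter fun σ : Equiv.Perm α ↦ σ.partition = p)
      = Finset.univ.filter fun σ : Equiv.Perm α ↦ σ.cycleType = c := by
    refine Finset.filter_congr fun σ _ ↦ ⟨fun h ↦ ?_, fun h ↦ ?_⟩
    · rw [← Equiv.Perm.filter_parts_partition_eq_cycleType, h]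
    · rw [Nat.Partition.ext_iff, Equiv.Perm.parts_partition, hparts, ← Equiv.Perm.sum_cycleType, h]
      congr 2
      omega
  have hord : centralizerOrder p.parts
      = (Fintype.card α - c.sum)! * c.prod * ∏ i ∈ c.toFinset, (c.count i)! := by
    have h1 : 1 ∉ c.toFinset := fun h ↦ by
      have := hc2 1 (Multiset.mem_toFinset.1 h)
      omega
    rw [centralizerOrder_eq_of_subset (t := insert 1 c.toFinset), Finset.prod_insert h1, ← hk,
      show Fintype.card α - c.sum = k by omega]
    · have : ∏ i ∈ c.toFinset, (p.parts.count i)! = ∏ i ∈ c.toFinset, (c.count i)! := by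
        refine Finset.prod_congr rfl fun i hi ↦ ?_
        have : i ≠ 1 := fun h ↦ h1 (h ▸ hi)
        rw [hparts, Multiset.count_add, Multiset.count_replicate, if_neg this.symm, add_zero]
      rw [this]
      conv_lhs => rw [hparts]
      simp only [Multiset.prod_add, Multiset.prod_replicate, one_pow, mul_one]
      ring
    · rw [hparts]
      intro i
      simp only [Multiset.mem_toFinset, Multiset.mem_add, Multiset.mem_replicate,
        Finset.mem_insert]
      tauto
  rw [hset, hord, Equiv.Perm.card_of_cycleType_mul_eq, if_pos ⟨by omega, hc2⟩]

-- The size is a variable `n` because partitions of permutations of `Fin n` are indexed by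
-- `Fintype.card (Fin n)`, not by `n` itself.
open scoped Nat in
theorem sum_perm_partition {α : Type*} [Fintype α] [DecidableEq α] {n : ℕ}
    (hn : Fintype.card α = n) (F : Multiset ℕ → ℂ) :
    ∑ σ : Equiv.Perm α, F σ.partition.parts
      = n ! * ∑ p : n.Partition, F p.parts / centralizerOrder p.parts := by
  subst hn
  rw [← Finset.sum_fiberwise Finset.univ (fun σ : Equiv.Perm α ↦ σ.partition), Finset.mul_sum]
  refine Finset.sum_congr rfl fun p _ ↦ ?_
  rw [Finset.sum_congr rfl (g := fun _ ↦ F p.parts)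
    fun σ hσ ↦ by rw [(Finset.mem_filter.1 hσ).2], Finset.sum_const,
    ← card_partition_eq_mul_centralizerOrder p]
  have : (centralizerOrder p.parts : ℂ) ≠ 0 := by exact_mod_cast (centralizerOrder_pos p).ne'
  push_cast
  rw [nsmul_eq_mul]
  field_simp

theorem integral_uniformPerm (n : ℕ) (F : Multiset ℕ → ℂ) :
    ∫ σ, F σ.partition.parts ∂(uniformPerm n)
      = ∑ p : n.Partition, F p.parts / centralizerOrder p.parts := by
  have h := sum_perm_partition (Fintype.card_fin n) F
  have hn : (n.factorial : ℂ) ≠ 0 := by exact_mod_cast n.factorial_ne_zero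
  rw [uniformPerm, PMF.integral_eq_sum]
  simp only [PMF.uniformOfFintype_apply, Fintype.card_perm, Fintype.card_fin, ENNReal.toReal_inv,
    ENNReal.toReal_natCast, Complex.real_smul, ← Finset.mul_sum]
  rw [h]
  push_cast
  field_simp

/-- The cycle index of the symmetric group `S_n`: the mean over `S_n` of the product of `z m` over
the cycle lengths `m`. -/
noncomputable def symmCycleIndex (z : ℕ → ℂ) (n : ℕ) : ℂ :=
  ∑ p : n.Partition, (p.parts.map z).prod / centralizerOrder p.parts

theorem symmCycleIndex_zero (z : ℕ → ℂ) : symmCycleIndex z 0 = 1 := by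
  simp [symmCycleIndex, centralizerOrder]

/-- Write `n` as the sum of `m * count m` over the part sizes of each partition. Removing one part
`m` is a bijection from the partitions of `n` containing `m` to those of `n - m`, and by
`centralizerOrder_cons` it cancels exactly the weight `m * count m`. -/
theorem mul_symmCycleIndex (z : ℕ → ℂ) (n : ℕ) :
    n * symmCycleIndex z n = ∑ m ∈ Finset.Icc 1 n, z m * symmCycleIndex z (n - m) := by
  have hsum (p : n.Partition) : (n : ℂ) = ∑ m ∈ Finset.Icc 1 n, (p.parts.count m * m : ℂ) := by
    have h := p.parts_sum
    rw [Finset.sum_multiset_count_of_subset p.parts (Finset.Icc 1 n)] at h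
    · conv_lhs => rw [← h]
      simp
    · intro i hi
      rw [Multiset.mem_toFinset] at hi
      exact Finset.mem_Icc.2 ⟨p.parts_pos hi, p.le_of_mem_parts hi⟩
  have h1 : n * symmCycleIndex z n = ∑ m ∈ Finset.Icc 1 n, ∑ p : n.Partition,
      (p.parts.count m * m : ℂ) * ((p.parts.map z).prod / centralizerOrder p.parts) := by
    rw [symmCycleIndex, Finset.mul_sum, Finset.sum_comm]
    refine Finset.sum_congr rfl fun p _ ↦ ?_
    rw [← Finset.sum_mul, ← hsum]
  rw [h1]
  refine Finset.sum_congr rfl fun m hm ↦ ?_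
  obtain ⟨hm1, hmn⟩ := Finset.mem_Icc.1 hm
  have hne : ∀ p ∈ (Finset.univ : Finset n.Partition), (p.parts.count m * m : ℂ) *
      ((p.parts.map z).prod / centralizerOrder p.parts) ≠ 0 → m ∈ p.parts := fun p _ h ↦ by
    by_contra hp
    simp [Multiset.count_eq_zero_of_notMem hp] at h
  rw [symmCycleIndex, Finset.mul_sum, ← Finset.sum_filter_of_ne hne,
    Finset.sum_subtype (p := fun p : n.Partition ↦ m ∈ p.parts) _ (by simp),
    ← (Nat.Partition.partitionWithPartEquiv hm1 hmn).symm.sum_comp]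
  refine Finset.sum_congr rfl fun q _ ↦ ?_
  rw [Nat.Partition.partitionWithPartEquiv_symm_apply_parts, centralizerOrder_cons,
    Multiset.count_cons_self, Multiset.map_cons, Multiset.prod_cons]
  have hq : (centralizerOrder q.parts : ℂ) ≠ 0 := by exact_mod_cast (centralizerOrder_pos q).ne'
  have hm0 : (m : ℂ) ≠ 0 := by exact_mod_cast (by omega : m ≠ 0)
  have hc : (q.parts.count m + 1 : ℂ) ≠ 0 := by
    exact_mod_cast (q.parts.count m).succ_ne_zero
  push_cast
  field_simp

/-! ### Asymptotics of the coefficient recursion -/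

/-- Multiplying a solution of the recursion for the coefficients of an exponential by the geometric
series: the partial sums satisfy the recursion with all weights increased by one. -/
theorem succ_mul_sum_range_of_recursion {b v : ℕ → ℂ}
    (hb : ∀ n : ℕ, (n + 1 : ℂ) * b (n + 1) = ∑ i ∈ Finset.range (n + 1), v i * b (n - i)) (n : ℕ) :
    (n + 1 : ℂ) * ∑ j ∈ Finset.range (n + 2), b j
      = ∑ i ∈ Finset.range (n + 1), (1 + v i) * ∑ j ∈ Finset.range (n - i + 1), b j := by
  induction n with
  | zero =>
    have := hb 0
    simp [Finset.sum_range_succ] at this ⊢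
    rw [this]
    ring
  | succ n ih =>
    -- Each inner sum gains one last term `b (n + 1 - i)`. Those of weight `1` add up to a reversed
    -- partial sum (`h2`), those of weight `v i` to the recursion for `b` (`h3`).
    have h1 : ∀ i ∈ Finset.range (n + 1), (1 + v i) * ∑ j ∈ Finset.range (n + 1 - i + 1), b j
        = (1 + v i) * ∑ j ∈ Finset.range (n - i + 1), b j + b (n + 1 - i)
          + v i * b (n + 1 - i) := fun i hi ↦ by
      have hi' := Finset.mem_range.1 hi
      rw [show n + 1 - i + 1 = n - i + 1 + 1 by omega, Finset.sum_range_succ,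
        show n - i + 1 = n + 1 - i by omega]
      ring
    have h2 : ∑ j ∈ Finset.range (n + 2), b j
        = ∑ i ∈ Finset.range (n + 1), b (n + 1 - i) + b 0 := by
      rw [← Finset.sum_range_reflect, Finset.sum_range_succ]
      simp
    have h3 := hb (n + 1)
    rw [Finset.sum_range_succ] at h3
    rw [Finset.sum_range_succ (n := n + 1), Finset.sum_congr rfl h1, Finset.sum_add_distrib,
      Finset.sum_add_distrib, ← ih, Finset.sum_range_succ (n := n + 2)]
    push_cast at h3 ⊢
    simp only [Nat.sub_self, zero_add, Finset.range_one, Finset.sum_singleton] at h3 ⊢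
    linear_combination h3 + h2

theorem eq_of_recursion {a c u : ℕ → ℂ} (h0 : a 0 = c 0)
    (ha : ∀ n : ℕ, (n + 1 : ℂ) * a (n + 1) = ∑ i ∈ Finset.range (n + 1), u i * a (n - i))
    (hc : ∀ n : ℕ, (n + 1 : ℂ) * c (n + 1) = ∑ i ∈ Finset.range (n + 1), u i * c (n - i)) (n : ℕ) :
    a n = c n := by
  induction n using Nat.strong_induction_on with
  | _ n ih =>
    cases n with
    | zero => exact h0
    | succ n =>
      have hn : (n + 1 : ℂ) ≠ 0 := by exact_mod_cast n.succ_ne_zero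
      refine mul_left_cancel₀ hn ?_
      rw [ha, hc]
      refine Finset.sum_congr rfl fun i _ ↦ ?_
      rw [ih (n - i) (by omega)]

/-- If the power series `∑ v i * u ^ i` has radius of convergence larger than `1`, then so has the
exponential of its primitive, whose coefficients satisfy the associated recursion. -/
theorem exists_hasSum_exp_of_recursion {v : ℕ → ℂ} {C r : ℝ} (hr0 : 0 ≤ r) (hr1 : r < 1)
    (hv : ∀ i, ‖v i‖ ≤ C * r ^ i) :
    ∃ b : ℕ → ℂ, b 0 = 1 ∧
      (∀ n : ℕ, (n + 1 : ℂ) * b (n + 1) = ∑ i ∈ Finset.range (n + 1), v i * b (n - i)) ∧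
      HasSum b (Complex.exp (∑' i, v i / (i + 1))) := by
  -- A radius `R > 1` with `r * R < 1`: here `r * (2 - r) = 1 - (1 - r) ^ 2`.
  set R : ℝ := 2 - r
  have hR1 : 1 < R := by simp only [R]; linarith
  have hrR : r * R < 1 := by simp only [R]; nlinarith
  set B := Metric.ball (0 : ℂ) R
  have h0B : (0 : ℂ) ∈ B := Metric.mem_ball_self (by linarith)
  have h1B : (1 : ℂ) ∈ B := by simpa [B] using hR1
  have hBo : IsOpen B := Metric.isOpen_ball
  have hbound : ∀ (i : ℕ) (y : ℂ), y ∈ B → ‖v i * y ^ i‖ ≤ C * (r * R) ^ i := fun i y hy ↦ by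
    have hyR : ‖y‖ ≤ R := (mem_ball_zero_iff.1 hy).le
    rw [norm_mul, norm_pow, mul_pow, ← mul_assoc]
    exact mul_le_mul (hv i) (pow_le_pow_left₀ (norm_nonneg _) hyR i) (by positivity)
      ((norm_nonneg _).trans (hv i))
  have hsum : Summable fun i : ℕ ↦ C * (r * R) ^ i :=
    (summable_geometric_of_lt_one (by positivity) hrR).mul_left C
  set V : ℂ → ℂ := fun y ↦ ∑' i, v i * y ^ i with hVdef
  set W : ℂ → ℂ := fun y ↦ ∑' i : ℕ, v i * y ^ (i + 1) / (i + 1) with hWdef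
  have hW : ∀ y ∈ B, HasDerivAt W (V y) y := fun y hy ↦ by
    refine hasDerivAt_tsum_of_isPreconnected hsum hBo (convex_ball 0 R).isPreconnected
      (fun i y _ ↦ ?_) hbound h0B (by simp) hy
    have hi : (i + 1 : ℂ) ≠ 0 := by exact_mod_cast i.succ_ne_zero
    refine (((hasDerivAt_pow (i + 1) y).const_mul (v i)).div_const (i + 1 : ℂ)).congr_deriv ?_
    push_cast
    rw [mul_left_comm, mul_div_cancel_left₀ _ hi]
  set g : ℂ → ℂ := fun y ↦ Complex.exp (W y) with hgdef
  have hg : ∀ y ∈ B, HasDerivAt g (V y * g y) y := fun y hy ↦ by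
    simpa [mul_comm] using (hW y hy).cexp
  have hgd : DifferentiableOn ℂ g B := fun y hy ↦ (hg y hy).differentiableAt.differentiableWithinAt
  have hVp : HasFPowerSeriesAt V (FormalMultilinearSeries.ofScalars ℂ v) 0 := by
    rw [hasFPowerSeriesAt_iff]
    filter_upwards [hBo.mem_nhds h0B] with y hy
    have : Summable fun i ↦ v i * y ^ i := .of_norm_bounded hsum fun i ↦ hbound i y hy
    simpa [FormalMultilinearSeries.coeff_ofScalars, hVdef, mul_comm] using this.hasSum
  have hVa : AnalyticAt ℂ V 0 := ⟨_, hVp⟩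
  have hga : AnalyticAt ℂ g 0 := hgd.analyticAt (hBo.mem_nhds h0B)
  have hVc (i : ℕ) : iteratedDeriv i V 0 = v i * i.factorial := by
    have := congrArg (fun p ↦ p.coeff i) (hVp.eq_formalMultilinearSeries hVa.hasFPowerSeriesAt)
    simp only [FormalMultilinearSeries.coeff_ofScalars] at this
    have hi : (i.factorial : ℂ) ≠ 0 := by exact_mod_cast i.factorial_ne_zero
    rw [this]
    field_simp
  have hderiv : deriv g =ᶠ[nhds 0] V * g := by
    filter_upwards [hBo.mem_nhds h0B] with y hy using (hg y hy).deriv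
  -- `b` consists of the Taylor coefficients of `g = exp W` at `0`. The recursion is Leibniz's rule
  -- for the `n`-th derivative of `g' = V * g`; the sum is the Taylor series at `1`, a point inside
  -- the ball.
  refine ⟨fun n ↦ (n.factorial : ℂ)⁻¹ * iteratedDeriv n g 0, ?_, fun n ↦ ?_, ?_⟩
  · simp [hgdef, hWdef]
  · have hn : (n + 1 : ℂ) ≠ 0 := by exact_mod_cast n.succ_ne_zero
    have hn' : (n.factorial : ℂ) ≠ 0 := by exact_mod_cast n.factorial_ne_zero
    simp only
    rw [iteratedDeriv_succ', hderiv.iteratedDeriv_eq, iteratedDeriv_mul hVa.contDiffAt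
      hga.contDiffAt, Nat.factorial_succ, Finset.mul_sum, Finset.mul_sum]
    refine Finset.sum_congr rfl fun i hi ↦ ?_
    have hi' : i ≤ n := Nat.lt_succ_iff.1 (Finset.mem_range.1 hi)
    have h1 : (i.factorial : ℂ) ≠ 0 := by exact_mod_cast i.factorial_ne_zero
    have h2 : ((n - i).factorial : ℂ) ≠ 0 := by exact_mod_cast (n - i).factorial_ne_zero
    rw [hVc, Nat.cast_choose ℂ hi']
    push_cast
    field_simp
  · have := Complex.hasSum_taylorSeries_on_ball hgd h1B
    simpa [hgdef, hWdef] using this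

theorem tendsto_of_recursion {a v : ℕ → ℂ} {C r : ℝ} (hr0 : 0 ≤ r) (hr1 : r < 1)
    (hv : ∀ i, ‖v i‖ ≤ C * r ^ i) (h0 : a 0 = 1)
    (ha : ∀ n : ℕ, (n + 1 : ℂ) * a (n + 1) = ∑ i ∈ Finset.range (n + 1), (1 + v i) * a (n - i)) :
    Tendsto a atTop (nhds (Complex.exp (∑' i, v i / (i + 1)))) := by
  obtain ⟨b, hb0, hb, hsum⟩ := exists_hasSum_exp_of_recursion hr0 hr1 hv
  have hab : a = fun n ↦ ∑ j ∈ Finset.range (n + 1), b j :=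
    funext <| eq_of_recursion (by simp [h0, hb0]) ha (succ_mul_sum_range_of_recursion hb)
  rw [hab]
  exact hsum.tendsto_sum_nat.comp (tendsto_add_atTop_nat 1)

theorem tendsto_symmCycleIndex {z : ℕ → ℂ} {C r : ℝ} (hr0 : 0 ≤ r) (hr1 : r < 1)
    (hz : ∀ i, ‖z (i + 1) - 1‖ ≤ C * r ^ i) :
    Tendsto (symmCycleIndex z) atTop
      (nhds (Complex.exp (∑' i : ℕ, (z (i + 1) - 1) / (i + 1)))) := by
  refine tendsto_of_recursion hr0 hr1 hz (symmCycleIndex_zero z) fun n ↦ ?_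
  have := mul_symmCycleIndex z (n + 1)
  push_cast at this
  rw [this, Finset.range_eq_Ico, Finset.sum_Ico_eq_sum_range, ← Finset.Ico_succ_right_eq_Icc,
    Finset.sum_Ico_eq_sum_range]
  refine Finset.sum_congr (by simp) fun i _ ↦ ?_
  rw [zero_add, add_comm 1 i, Nat.add_sub_add_right]
  ring

/-! ### Geometric bounds for the logarithms -/

theorem one_sub_pow_ne_zero {x : ℂ} (hx : ‖x‖ < 1) {m : ℕ} (hm : m ≠ 0) : 1 - x ^ m ≠ 0 := by
  intro h
  have h1 : ‖x ^ m‖ = 1 := by rw [← sub_eq_zero.1 h, norm_one]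
  rw [norm_pow] at h1
  exact (pow_lt_one₀ (norm_nonneg x) hx hm).ne h1

theorem norm_log_one_sub_pow_le {x : ℂ} (hx : ‖x‖ < 1) {m : ℕ} (hm : m ≠ 0) :
    ‖Complex.log (1 - x ^ m)‖ ≤ ((1 - ‖x‖)⁻¹ + 1) * ‖x‖ ^ m := by
  have h1 : ‖x‖ ^ m ≤ ‖x‖ := pow_le_of_le_one (norm_nonneg x) hx.le hm
  have h0 : 0 ≤ ‖x‖ ^ m := by positivity
  -- The bound is `‖z‖ ^ 2 * (1 - ‖z‖)⁻¹ / 2 + ‖z‖` with `z = -x ^ m`; the `1 / 2` is dropped.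
  have h := Complex.norm_log_one_add_le (z := -x ^ m) (by rw [norm_neg, norm_pow]; linarith)
  rw [norm_neg, norm_pow, ← sub_eq_add_neg] at h
  refine h.trans ?_
  have h2 : (1 - ‖x‖ ^ m)⁻¹ ≤ (1 - ‖x‖)⁻¹ := inv_anti₀ (by linarith) (by linarith)
  have h3 : 0 ≤ (1 - ‖x‖ ^ m)⁻¹ := inv_nonneg.2 (by linarith)
  have h4 : (‖x‖ ^ m) ^ 2 ≤ ‖x‖ ^ m := pow_le_of_le_one h0 (by linarith) two_ne_zero
  have h5 : (‖x‖ ^ m) ^ 2 * (1 - ‖x‖ ^ m)⁻¹ ≤ ‖x‖ ^ m * (1 - ‖x‖)⁻¹ :=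
    mul_le_mul h4 h2 h3 h0
  have h6 : 0 ≤ ‖x‖ ^ m * (1 - ‖x‖)⁻¹ := mul_nonneg h0 (h3.trans h2)
  linarith

theorem summable_norm_log_one_sub_pow {x : ℂ} (hx : ‖x‖ < 1) :
    Summable fun m : ℕ+ ↦ ‖Complex.log (1 - x ^ (m : ℕ))‖ := by
  refine .of_nonneg_of_le (fun _ ↦ norm_nonneg _)
    (fun m ↦ norm_log_one_sub_pow_le hx m.ne_zero) (Summable.mul_left _ ?_)
  exact (summable_geometric_of_lt_one (norm_nonneg x) hx).comp_injective PNat.coe_injective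

/-! ### The characteristic function on the symmetric group -/

/-- The phase `exp (i ⟪s Log (1 - x ^ m), t⟫)` which one cycle of length `m` contributes to the
characteristic function of `log Z`. -/
noncomputable def cyclePhase (s x t : ℂ) (m : ℕ) : ℂ :=
  Complex.exp (inner ℝ (s * Complex.log (1 - x ^ m)) t * Complex.I)

theorem norm_cyclePhase_sub_one_le (s x t : ℂ) (m : ℕ) :
    ‖cyclePhase s x t m - 1‖ ≤ ‖s‖ * ‖t‖ * ‖Complex.log (1 - x ^ m)‖ := by
  rw [cyclePhase, mul_comm _ Complex.I]
  refine Real.norm_exp_I_mul_ofReal_sub_one_le.trans ((norm_inner_le_norm _ _).trans_eq ?_)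
  rw [norm_mul]
  ring

theorem summable_cyclePhase {x : ℂ} (hx : ‖x‖ < 1) (s t : ℂ) :
    Summable fun m : ℕ+ ↦ (cyclePhase s x t m - 1) / (m : ℕ) := by
  refine .of_norm_bounded ((summable_norm_log_one_sub_pow hx).mul_left (‖s‖ * ‖t‖)) fun m ↦ ?_
  rw [norm_div, Complex.norm_natCast]
  have hm : (1 : ℝ) ≤ (m : ℕ) := by exact_mod_cast m.pos
  exact (div_le_self (norm_nonneg _) hm).trans (norm_cyclePhase_sub_one_le s x t m)

theorem exp_inner_logZ (n : ℕ) (s x t : ℂ) (σ : Equiv.Perm (Fin n)) :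
    Complex.exp (inner ℝ (logZ n s x σ) t * Complex.I)
      = (σ.partition.parts.map (cyclePhase s x t)).prod := by
  rw [Finset.prod_multiset_map_count, Finset.prod_subset (s₂ := Finset.Icc 1 n), logZ,
    Finset.mul_sum, sum_inner, Complex.ofReal_sum, Finset.sum_mul, Complex.exp_sum]
  · refine Finset.prod_congr rfl fun m _ ↦ ?_
    rw [cyclePhase, ← Complex.exp_nat_mul, cycleCount, mul_left_comm, ← nsmul_eq_mul,
      ← Nat.cast_smul_eq_nsmul ℝ, real_inner_smul_left]
    push_cast
    rw [mul_assoc]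
  · intro i hi
    rw [Multiset.mem_toFinset] at hi
    refine Finset.mem_Icc.2 ⟨σ.partition.parts_pos hi, ?_⟩
    simpa using σ.partition.le_of_mem_parts hi
  · intro i _ hi
    rw [Multiset.mem_toFinset] at hi
    rw [Multiset.count_eq_zero_of_notMem hi, pow_zero]

theorem measurable_logZ (n : ℕ) (s x : ℂ) : Measurable (logZ n s x) :=
  measurable_from_top

theorem charFun_map_logZ (n : ℕ) (s x t : ℂ) :
    charFun ((uniformPerm n).map (logZ n s x)) t = symmCycleIndex (cyclePhase s x t) n := by
  rw [charFun_apply, integral_map (measurable_logZ n s x).aemeasurable (by fun_prop)]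
  simp_rw [exp_inner_logZ]
  exact integral_uniformPerm n fun p ↦ (p.map (cyclePhase s x t)).prod

theorem tendsto_charFun_map_logZ {x : ℂ} (hx : ‖x‖ < 1) (s t : ℂ) :
    Tendsto (fun n ↦ charFun ((uniformPerm n).map (logZ n s x)) t) atTop
      (nhds (Complex.exp (∑' m : ℕ+, (cyclePhase s x t m - 1) / (m : ℕ)))) := by
  simp_rw [charFun_map_logZ]
  rw [tsum_pnat_eq_tsum_succ (f := fun m : ℕ ↦ (cyclePhase s x t m - 1) / (m : ℂ))]
  push_cast
  refine tendsto_symmCycleIndex (C := ‖s‖ * ‖t‖ * (((1 - ‖x‖)⁻¹ + 1) * ‖x‖)) (norm_nonneg x) hx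
    fun i ↦ (norm_cyclePhase_sub_one_le s x t (i + 1)).trans ?_
  have := norm_log_one_sub_pow_le hx i.succ_ne_zero
  calc ‖s‖ * ‖t‖ * ‖Complex.log (1 - x ^ (i + 1))‖
      ≤ ‖s‖ * ‖t‖ * (((1 - ‖x‖)⁻¹ + 1) * ‖x‖ ^ (i + 1)) := by gcongr
    _ = _ := by ring

/-! ### The Poisson series and its characteristic function -/

open scoped ENNReal in
theorem lintegral_natCast_poissonMeasure (r : ℝ≥0) :
    ∫⁻ k, (k : ℝ≥0∞) ∂(poissonMeasure r) = r := by
  have hone := hasSum_one_poissonMeasure r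
  -- Poisson weights satisfy `(n + 1) * p (n + 1) = r * p n`, which reduces the mean to the total
  -- mass.
  have hterm (n : ℕ) : ENNReal.ofReal (Real.exp (-r) * r ^ (n + 1) / (n + 1).factorial)
      * ((n + 1 : ℕ) : ℝ≥0∞) = r * ENNReal.ofReal (Real.exp (-r) * r ^ n / n.factorial) := by
    rw [← ENNReal.ofReal_natCast, ← ENNReal.ofReal_coe_nnreal,
      ← ENNReal.ofReal_mul (by positivity), ← ENNReal.ofReal_mul (by positivity)]
    congr 1
    rw [Nat.factorial_succ]
    push_cast
    field_simp
    ring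
  rw [poissonMeasure, lintegral_sum_measure]
  simp only [lintegral_smul_measure, lintegral_dirac, smul_eq_mul]
  rw [tsum_eq_zero_add' ENNReal.summable]
  simp only [hterm, ENNReal.tsum_mul_left, Nat.cast_zero, mul_zero, zero_add]
  rw [← ENNReal.ofReal_tsum_of_nonneg (fun n ↦ by positivity) hone.summable, hone.tsum_eq]
  simp

theorem aemeasurable_poisson_mul {Ω : Type*} [MeasurableSpace Ω] {P : Measure Ω}
    {r : ℝ≥0} {Z : Ω → ℕ} (hZ : HasLaw Z (poissonMeasure r) P)
    (w : ℂ) : AEMeasurable (fun ω ↦ (Z ω : ℂ) * w) P :=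
  ((measurable_from_top (f := fun k : ℕ ↦ (k : ℂ))).comp_aemeasurable hZ.aemeasurable).mul_const w

theorem charFun_map_natCast_mul_of_poisson {Ω : Type*} [MeasurableSpace Ω] {P : Measure Ω}
    {Y : Ω → ℕ} {r : ℝ≥0} (hY : HasLaw Y (poissonMeasure r) P) (w t : ℂ) :
    charFun (P.map fun ω ↦ (Y ω : ℂ) * w) t
      = Complex.exp (r * (Complex.exp (inner ℝ w t * Complex.I) - 1)) := by
  rw [← charFun_map_cast_poissonMeasure, charFun_apply, charFun_apply,
    integral_map (aemeasurable_poisson_mul hY w) (by fun_prop),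
    integral_map .of_discrete (by fun_prop), ← hY.map_eq,
    integral_map hY.aemeasurable .of_discrete]
  refine integral_congr_ae (.of_forall fun ω ↦ ?_)
  simp only
  rw [← nsmul_eq_mul, ← Nat.cast_smul_eq_nsmul ℝ, real_inner_smul_left, Real.inner_apply]

-- The means `1 / m` are at most `1`, so the sum of the `L¹` norms is bounded by the convergent
-- series of `‖Log (1 - x ^ m)‖`.
open scoped ENNReal in
theorem ae_summable_poisson_mul_log {Ω : Type*} [MeasurableSpace Ω] {P : Measure Ω} {Y : ℕ+ → Ω → ℕ}
    (hY : ∀ m : ℕ+, HasLaw (Y m) (poissonMeasure (1 / ((m : ℕ) : ℝ≥0))) P)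
    {x : ℂ} (hx : ‖x‖ < 1) :
    ∀ᵐ ω ∂P, Summable fun m : ℕ+ ↦ (Y m ω : ℂ) * Complex.log (1 - x ^ (m : ℕ)) := by
  have hle (m : ℕ+) : eLpNorm (fun ω ↦ (Y m ω : ℂ) * Complex.log (1 - x ^ (m : ℕ))) 1 P
      ≤ ‖Complex.log (1 - x ^ (m : ℕ))‖ₑ := by
    have h1 : ∫⁻ ω, (Y m ω : ℝ≥0∞) ∂P ≤ 1 := by
      rw [(hY m).lintegral_comp (f := fun k : ℕ ↦ (k : ℝ≥0∞)) (by fun_prop),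
        lintegral_natCast_poissonMeasure, ENNReal.coe_le_one_iff]
      exact div_le_one_of_le₀ (by exact_mod_cast m.pos) (by positivity)
    have h2 (ω : Ω) : ‖(Y m ω : ℂ)‖ₑ = (Y m ω : ℝ≥0∞) := by
      rw [← ofReal_norm, Complex.norm_natCast, ENNReal.ofReal_natCast]
    simp_rw [eLpNorm_one_eq_lintegral_enorm, enorm_mul, h2]
    rw [lintegral_mul_const' _ _ enorm_ne_top]
    exact mul_le_of_le_one_left' h1
  have hne : ∑' m : ℕ+, eLpNorm (fun ω ↦ (Y m ω : ℂ) * Complex.log (1 - x ^ (m : ℕ))) 1 P ≠ ∞ :=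
    ne_top_of_le_ne_top (tsum_enorm_ne_top_iff_summable_norm.2 (summable_norm_log_one_sub_pow hx))
      (ENNReal.tsum_le_tsum hle)
  filter_upwards [summable_norm_of_tsum_eLpNorm_ne_top le_rfl
    (fun m ↦ (aemeasurable_poisson_mul (hY m) _).aestronglyMeasurable) hne] with ω hω
  exact hω.of_norm

theorem ae_tendsto_sum_logZInf {Ω : Type*} [MeasurableSpace Ω] {P : Measure Ω} {Y : ℕ+ → Ω → ℕ}
    (hY : ∀ m : ℕ+, HasLaw (Y m) (poissonMeasure (1 / ((m : ℕ) : ℝ≥0))) P)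
    {x : ℂ} (hx : ‖x‖ < 1) (s : ℂ) :
    ∀ᵐ ω ∂P, Tendsto (fun S : Finset ℕ+ ↦
      ∑ m ∈ S, (Y m ω : ℂ) * (s * Complex.log (1 - x ^ (m : ℕ)))) atTop
      (nhds (logZInf s x fun m ↦ Y m ω)) := by
  filter_upwards [ae_summable_poisson_mul_log hY hx] with ω hω
  simpa only [mul_left_comm, logZInf] using! hω.hasSum.mul_left s

theorem aemeasurable_logZInf {Ω : Type*} [MeasurableSpace Ω] {P : Measure Ω} {Y : ℕ+ → Ω → ℕ}
    (hY : ∀ m : ℕ+, HasLaw (Y m) (poissonMeasure (1 / ((m : ℕ) : ℝ≥0))) P)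
    {x : ℂ} (hx : ‖x‖ < 1) (s : ℂ) : AEMeasurable (fun ω ↦ logZInf s x fun m ↦ Y m ω) P :=
  aemeasurable_of_tendsto_metrizable_ae atTop
    (fun S ↦ S.aemeasurable_fun_sum fun m _ ↦ aemeasurable_poisson_mul (hY m) _)
    (ae_tendsto_sum_logZInf hY hx s)

/-- For finite partial sums, independence gives a product of Poisson characteristic functions.
Dominated convergence, with bound `1`, carries this to the limit along finite sets. -/
theorem charFun_map_logZInf {Ω : Type*} [MeasurableSpace Ω] {P : Measure Ω} {Y : ℕ+ → Ω → ℕ}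
    (hY : ∀ m : ℕ+, HasLaw (Y m) (poissonMeasure (1 / ((m : ℕ) : ℝ≥0))) P)
    {x : ℂ} (hx : ‖x‖ < 1)
    [IsProbabilityMeasure P] (hindep : iIndepFun Y P) (s t : ℂ) :
    charFun (P.map fun ω ↦ logZInf s x fun m ↦ Y m ω) t
      = Complex.exp (∑' m : ℕ+, (cyclePhase s x t m - 1) / (m : ℕ)) := by
  have hmeas (m : ℕ+) := aemeasurable_poisson_mul (hY m) (s * Complex.log (1 - x ^ (m : ℕ)))
  have hmeasS (S : Finset ℕ+) := S.aemeasurable_fun_sum fun m _ ↦ hmeas m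
  have hind : iIndepFun (fun (m : ℕ+) ω ↦ (Y m ω : ℂ) * (s * Complex.log (1 - x ^ (m : ℕ)))) P :=
    hindep.comp (fun m k ↦ (k : ℂ) * (s * Complex.log (1 - x ^ (m : ℕ))))
      fun _ ↦ measurable_from_top
  have hfin (S : Finset ℕ+) :
      charFun (P.map fun ω ↦ ∑ m ∈ S, (Y m ω : ℂ) * (s * Complex.log (1 - x ^ (m : ℕ)))) t
        = Complex.exp (∑ m ∈ S, (cyclePhase s x t m - 1) / (m : ℕ)) := by
    rw [(hind.restrict S).charFun_map_fun_finsetSum_eq_prod fun m _ ↦ hmeas m, Finset.prod_apply,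
      Complex.exp_sum]
    refine Finset.prod_congr rfl fun m _ ↦ ?_
    rw [charFun_map_natCast_mul_of_poisson (hY m), cyclePhase]
    push_cast
    congr 1
    ring
  have hlim : Tendsto (fun S : Finset ℕ+ ↦
      charFun (P.map fun ω ↦ ∑ m ∈ S, (Y m ω : ℂ) * (s * Complex.log (1 - x ^ (m : ℕ)))) t) atTop
      (nhds (charFun (P.map fun ω ↦ logZInf s x fun m ↦ Y m ω) t)) := by
    simp_rw [charFun_apply]
    rw [integral_map (aemeasurable_logZInf hY hx s) (by fun_prop)]
    simp_rw [fun S ↦ integral_map (hmeasS S)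
      (f := fun y ↦ Complex.exp (inner ℝ y t * Complex.I)) (by fun_prop)]
    refine tendsto_integral_filter_of_dominated_convergence (fun _ ↦ 1) (.of_forall fun S ↦ ?_)
      (.of_forall fun S ↦ .of_forall fun ω ↦ (Complex.norm_exp_ofReal_mul_I _).le)
      (integrable_const 1) ?_
    · exact (Measurable.comp_aemeasurable (g := fun y : ℂ ↦
        Complex.exp (inner ℝ y t * Complex.I)) (by fun_prop) (hmeasS S)).aestronglyMeasurable
    · filter_upwards [ae_tendsto_sum_logZInf hY hx s] with ω hω
      exact ((by fun_prop : Continuous fun y : ℂ ↦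
        Complex.exp (inner ℝ y t * Complex.I)).tendsto _).comp hω
  refine tendsto_nhds_unique hlim ?_
  simp_rw [hfin]
  exact (Complex.continuous_exp.tendsto _).comp (summable_cyclePhase hx s t).hasSum

/-! ### Convergence in distribution -/

theorem tendstoInDistribution_logZ {Ω : Type*} [MeasurableSpace Ω] {P : Measure Ω} {Y : ℕ+ → Ω → ℕ}
    (hY : ∀ m : ℕ+, HasLaw (Y m) (poissonMeasure (1 / ((m : ℕ) : ℝ≥0))) P)
    {x : ℂ} (hx : ‖x‖ < 1)
    [IsProbabilityMeasure P] (hindep : iIndepFun Y P) (s : ℂ) :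
    TendstoInDistribution (fun n : ℕ ↦ logZ n s x) atTop
      (fun ω ↦ logZInf s x fun m ↦ Y m ω) uniformPerm P where
  forall_aemeasurable n := (measurable_logZ n s x).aemeasurable
  aemeasurable_limit := aemeasurable_logZInf hY hx s
  tendsto := ProbabilityMeasure.tendsto_of_tendsto_charFun fun t ↦ by
    simpa only [ProbabilityMeasure.coe_mk, charFun_map_logZInf hY hx hindep]
      using tendsto_charFun_map_logZ hx s t

/-- No branch ambiguity arises: a principal power of a nonzero base is by definition the exponential
of a multiple of its principal logarithm. -/
theorem exp_logZ {x : ℂ} (hx : ‖x‖ < 1) (n : ℕ) (s : ℂ) :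
    Complex.exp ∘ logZ n s x = charZ n s x := by
  funext σ
  simp only [Function.comp, logZ, charZ, Finset.mul_sum, Complex.exp_sum]
  refine Finset.prod_congr rfl fun m hm ↦ ?_
  have hm0 : m ≠ 0 := Nat.one_le_iff_ne_zero.1 (Finset.mem_Icc.1 hm).1
  rw [Complex.cpow_def_of_ne_zero (one_sub_pow_ne_zero hx hm0)]
  ring_nf

theorem hasProd_charZInf {x : ℂ} (hx : ‖x‖ < 1) (s : ℂ) {y : ℕ+ → ℕ}
    (hy : Summable fun m : ℕ+ ↦ (y m : ℂ) * Complex.log (1 - x ^ (m : ℕ))) :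
    HasProd (fun m : ℕ+ ↦ (1 - x ^ (m : ℕ)) ^ (s * (y m : ℂ))) (Complex.exp (logZInf s x y)) := by
  rw [logZInf]
  convert (hy.hasSum.mul_left s).cexp using 1
  funext m
  rw [Complex.cpow_def_of_ne_zero (one_sub_pow_ne_zero hx m.ne_zero), Function.comp]
  ring_nf

theorem mainTheorem5 {Ω : Type*} [MeasurableSpace Ω] (P : Measure Ω) [IsProbabilityMeasure P]
    (Y : ℕ+ → Ω → ℕ)
    (hY : ∀ m : ℕ+, HasLaw (Y m) (poissonMeasure (1 / ((m : ℕ) : ℝ≥0))) P)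
    (hindep : iIndepFun Y P)
    (x s : ℂ) (hx : ‖x‖ < 1) :
    (∀ᵐ ω ∂P, Summable fun m : ℕ+ ↦ (Y m ω : ℂ) * Complex.log (1 - x ^ (m : ℕ))) ∧
    (∀ᵐ ω ∂P, Multipliable fun m : ℕ+ ↦ (1 - x ^ (m : ℕ)) ^ (s * (Y m ω : ℂ))) ∧
    TendstoInDistribution (fun n : ℕ ↦ logZ n s x) atTop
      (fun ω ↦ logZInf s x (fun m ↦ Y m ω)) uniformPerm P ∧
    TendstoInDistribution (fun n : ℕ ↦ charZ n s x) atTop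
      (fun ω ↦ charZInf s x (fun m ↦ Y m ω)) uniformPerm P := by
  have hsum := ae_summable_poisson_mul_log hY hx
  have hlog := tendstoInDistribution_logZ hY hx hindep s
  refine ⟨hsum, ?_, hlog, ?_⟩
  · filter_upwards [hsum] with ω hω using (hasProd_charZInf hx s hω).multipliable
  -- Continuous mapping under `exp`. The limit is identified with the infinite product only where
  -- the series converges, hence almost surely.
  · refine (hlog.continuous_comp Complex.continuous_exp).congr
      (fun n ↦ .of_eq (exp_logZ hx n s)) ?_
    filter_upwards [hsum] with ω hω using (hasProd_charZInf hx s hω).tprod_eq.symm
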